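/- **Theorem 2.1.** Let $D$ be a (nondegenerate) convex quadrilateral in the Euclidean plane, and let $E$ be any ellipse inscribed in $D$, that is, an ellipse (possibly a circle) contained in $D$ and tangent to each of the four sides of $D$. Then $$\frac{\operatorname{Area}(E)}{\operatorname{Area}(D)}\le\frac{\pi}{4},$$ where $\operatorname{Area}(E)$ and $\operatorname{Area}(D)$ are the areas of the regions bounded by $E$ and $D$. Equality holds if and only if $D$ is a parallelogram and $E$ is tangent to the four sides of $D$ at their midpoints. -/

import Mathlib

/-- The Euclidean plane. -/
abbrev Plane : Type := EuclideanSpace ℝ (Fin 2)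

/-- The area (two-dimensional Lebesgue measure) of a plane set, as a real number. -/
noncomputable def area (S : Set Plane) : ℝ := (MeasureTheory.volume S).toReal

/-- An ellipse, given by its centre, an orthonormal frame of axis directions, and the lengths
`a, b > 0` of the two semi-axes (circles, `a = b`, are allowed). -/
structure Ellipse where
  center : Plane
  axes : OrthonormalBasis (Fin 2) ℝ Plane
  a : ℝ
  b : ℝ
  a_pos : 0 < a
  b_pos : 0 < b

namespace Ellipse

/-- `X ^ 2 / a ^ 2 + Y ^ 2 / b ^ 2`, where `(X, Y)` are the coordinates of `p` in the frame of the
axes of the ellipse, with origin at its centre. -/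
noncomputable def form (E : Ellipse) (p : Plane) : ℝ :=
  (E.axes.repr (p - E.center) 0) ^ 2 / E.a ^ 2 + (E.axes.repr (p - E.center) 1) ^ 2 / E.b ^ 2

/-- The ellipse as a curve. -/
def curve (E : Ellipse) : Set Plane := {p | E.form p = 1}

/-- The closed region bounded by the ellipse. -/
def region (E : Ellipse) : Set Plane := {p | E.form p ≤ 1}

/-- The line `l` is tangent to the ellipse at the point `q`: it meets the curve in `q` only. -/
def TangentAt (E : Ellipse) (l : AffineSubspace ℝ Plane) (q : Plane) : Prop :=
  (l : Set Plane) ∩ E.curve = {q}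

end Ellipse

namespace Polygon

/-- The line through the consecutive vertices `D i` and `D (i + 1)` of a quadrilateral. -/
noncomputable def sideLine (D : Polygon Plane 4) (i : Fin 4) : AffineSubspace ℝ Plane :=
  affineSpan ℝ {D i, D (i + 1)}

/-- The quadrilateral with consecutive vertices `D 0, D 1, D 2, D 3` is convex (and
nondegenerate): for each side, the two remaining vertices lie strictly on the same side of the
line through it. -/
def IsConvexQuadrilateral (D : Polygon Plane 4) : Prop :=
  ∀ i : Fin 4, (D.sideLine i).SSameSide (D (i + 2)) (D (i + 3))

/-- The closed region bounded by a convex quadrilateral. -/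
def region (D : Polygon Plane 4) : Set Plane := convexHull ℝ (Set.range D.vertices)

/-- Opposite sides are parallel. -/
def IsParallelogram (D : Polygon Plane 4) : Prop :=
  (D.sideLine 0).Parallel (D.sideLine 2) ∧ (D.sideLine 1).Parallel (D.sideLine 3)

end Polygon

namespace Ellipse

/-- `E` is inscribed in the quadrilateral `D`: it lies in `D` and is tangent to each of the four
sides of `D` at a point of that side. -/
def InscribedIn (E : Ellipse) (D : Polygon Plane 4) : Prop :=
  E.region ⊆ D.region ∧
    ∀ i : Fin 4, ∃ q ∈ segment ℝ (D i) (D (i + 1)), E.TangentAt (D.sideLine i) q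

/-- `E` is tangent to each of the four sides of `D` at the midpoint of that side. -/
def TangentAtMidpoints (E : Ellipse) (D : Polygon Plane 4) : Prop :=
  ∀ i : Fin 4, E.TangentAt (D.sideLine i) (midpoint ℝ (D i) (D (i + 1)))

end Ellipse

/-! Affine bijections preserve ratios of areas, midpoints, tangency and parallelism, so `E` may be
taken to be the unit circle (`Ellipse.exists_form_affineEquiv`, `area_image_div_area_image`) and the
quadrilateral positively oriented. For a quadrilateral circumscribed about the unit circle with
tangent lengths `t i`, cutting it into triangles at the centre gives area `s = t 0 + t 1 + t 2 + t
3` (`IsTangentLengths.area_eq`), so the ratio is `π / s`. Going once around the circle makes the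
first and third elementary symmetric functions of the `t i` agree (`IsTangentLengths.esymm_eq`);
geometrically, the angles `arctan (t i)` add up to `π`. The AM-GM type bound
`four_le_sum_of_esymm_eq` then yields `s ≥ 4`, with equality only if every `t i` is `1`. In that
case the touching points are midpoints and the quadrilateral is a square, whose affine images are
parallelograms. Conversely, touching at midpoints makes all `t i` equal to some `t`, and `4 t = 4 t
^ 3` forces `t = 1`. -/

open MeasureTheory

/-! ### Areas of triangles and convex quadrilaterals -/

/-- Twice the signed area of the triangle `A B C`. -/
def signedCross (A B C : Plane) : ℝ :=
  (B 0 - A 0) * (C 1 - A 1) - (B 1 - A 1) * (C 0 - A 0)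

theorem Plane.ext {x y : Plane} (h0 : x 0 = y 0) (h1 : x 1 = y 1) : x = y := by
  ext i
  fin_cases i
  · exact h0
  · exact h1

theorem convex_signedCross_nonneg (A B : Plane) : Convex ℝ {x | 0 ≤ signedCross A B x} := by
  intro x hx y hy a b ha hb hab
  simp only [Set.mem_ofPred_eq, signedCross, PiLp.add_apply, PiLp.smul_apply, smul_eq_mul]
    at hx hy ⊢
  obtain rfl : b = 1 - a := by linarith
  nlinarith [mul_nonneg ha hx, mul_nonneg hb hy]

/-- The triangle cut out by the three half-planes to the left of its sides. -/
def triangle (A B C : Plane) : Set Plane :=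
  {x | 0 ≤ signedCross A B x ∧ 0 ≤ signedCross B C x ∧ 0 ≤ signedCross C A x}

/-- The closed triangle with vertices `(0, 0)`, `(1, 0)`, `(0, 1)`. -/
def unitTriangle : Set Plane := {p | 0 ≤ p 0 ∧ 0 ≤ p 1 ∧ p 0 + p 1 ≤ 1}

theorem volume_prod_unitTriangle :
    volume {p : ℝ × ℝ | 0 ≤ p.1 ∧ 0 ≤ p.2 ∧ p.1 + p.2 ≤ 1} = ENNReal.ofReal (1 / 2) := by
  have hm : MeasurableSet {p : ℝ × ℝ | 0 ≤ p.1 ∧ 0 ≤ p.2 ∧ p.1 + p.2 ≤ 1} := by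
    apply IsClosed.measurableSet
    exact (isClosed_le continuous_const continuous_fst).inter
      ((isClosed_le continuous_const continuous_snd).inter
        (isClosed_le (continuous_fst.add continuous_snd) continuous_const))
  rw [Measure.volume_eq_prod, Measure.prod_apply hm]
  have hs : ∀ x : ℝ, volume (Prod.mk x ⁻¹' {p : ℝ × ℝ | 0 ≤ p.1 ∧ 0 ≤ p.2 ∧ p.1 + p.2 ≤ 1}) =
      (Set.Icc (0 : ℝ) 1).indicator (fun x => ENNReal.ofReal (1 - x)) x := by
    intro x
    by_cases hx : x ∈ Set.Icc (0 : ℝ) 1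
    · have : Prod.mk x ⁻¹' {p : ℝ × ℝ | 0 ≤ p.1 ∧ 0 ≤ p.2 ∧ p.1 + p.2 ≤ 1} =
          Set.Icc 0 (1 - x) := by
        ext y
        simp only [Set.mem_preimage, Set.mem_ofPred_eq, Set.mem_Icc]
        exact ⟨fun h => ⟨h.2.1, by linarith [h.2.2]⟩, fun h => ⟨hx.1, h.1, by linarith [h.2]⟩⟩
      rw [this, Set.indicator_of_mem hx, Real.volume_Icc, sub_zero]
    · have : Prod.mk x ⁻¹' {p : ℝ × ℝ | 0 ≤ p.1 ∧ 0 ≤ p.2 ∧ p.1 + p.2 ≤ 1} = ∅ := by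
        ext y
        simp only [Set.mem_preimage, Set.mem_ofPred_eq, Set.mem_empty_iff_false, iff_false]
        exact fun h => hx ⟨h.1, by linarith [h.2.1, h.2.2]⟩
      rw [this, Set.indicator_of_notMem hx, measure_empty]
  simp_rw [hs]
  rw [lintegral_indicator measurableSet_Icc, ← ofReal_integral_eq_lintegral_ofReal]
  · congr 1
    rw [integral_Icc_eq_integral_Ioc, ← intervalIntegral.integral_of_le zero_le_one]
    rw [intervalIntegral.integral_sub (by simp) (by simp)]
    norm_num
  · exact (continuous_const.sub continuous_id).integrableOn_Icc
  · filter_upwards [ae_restrict_mem measurableSet_Icc] with x hx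
    simpa using hx.2

theorem volume_unitTriangle : volume unitTriangle = ENNReal.ofReal (1 / 2) := by
  rw [← volume_prod_unitTriangle]
  have h := (volume_preserving_finTwoArrow ℝ).comp (PiLp.volume_preserving_ofLp (Fin 2))
  rw [← h.measure_preimage]
  · rfl
  · apply MeasurableSet.nullMeasurableSet
    apply IsClosed.measurableSet
    exact (isClosed_le continuous_const continuous_fst).inter
      ((isClosed_le continuous_const continuous_snd).inter
        (isClosed_le (continuous_fst.add continuous_snd) continuous_const))

/-- The linear map sending the standard basis to `u, v`. -/
def frameMap (u v : Plane) : Plane →ₗ[ℝ] Plane where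
  toFun p := p 0 • u + p 1 • v
  map_add' p q := by simp only [PiLp.add_apply]; module
  map_smul' c p := by simp only [PiLp.smul_apply, smul_eq_mul, RingHom.id_apply]; module

theorem det_frameMap (u v : Plane) : LinearMap.det (frameMap u v) = u 0 * v 1 - u 1 * v 0 := by
  rw [← LinearMap.det_toMatrix (EuclideanSpace.basisFun (Fin 2) ℝ).toBasis, Matrix.det_fin_two]
  simp [LinearMap.toMatrix_apply, frameMap]
  ring

/-- The three signed areas cut off by `x` add up to that of the whole triangle; divided by it, they
are the barycentric coordinates of `x`. -/
theorem mem_triangle_iff {A B C : Plane} (h : 0 < signedCross A B C) (x : Plane) :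
    x ∈ triangle A B C ↔ ∃ p ∈ unitTriangle, A + frameMap (B - A) (C - A) p = x := by
  constructor
  · rintro ⟨h1, h2, h3⟩
    have hsum : signedCross A B x + signedCross B C x + signedCross C A x = signedCross A B C := by
      simp only [signedCross]; ring
    refine ⟨!₂[signedCross C A x / signedCross A B C, signedCross A B x / signedCross A B C],
      ⟨?_, ?_, ?_⟩, ?_⟩
    · simpa using div_nonneg h3 h.le
    · simpa using div_nonneg h1 h.le
    · simp only [Matrix.cons_val_zero, Matrix.cons_val_one]
      rw [← add_div, div_le_one h]
      linarith
    · have h' := h.ne'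
      apply Plane.ext <;>
      · simp [frameMap]
        field_simp
        simp only [signedCross]
        ring
  · rintro ⟨p, ⟨h0, h1, h2⟩, rfl⟩
    refine ⟨?_, ?_, ?_⟩
    · have : signedCross A B (A + frameMap (B - A) (C - A) p) = p 1 * signedCross A B C := by
        simp [signedCross, frameMap]; ring
      rw [this]; positivity
    · have : signedCross B C (A + frameMap (B - A) (C - A) p) =
          (1 - p 0 - p 1) * signedCross A B C := by
        simp [signedCross, frameMap]; ring
      rw [this]; exact mul_nonneg (by linarith) h.le
    · have : signedCross C A (A + frameMap (B - A) (C - A) p) = p 0 * signedCross A B C := by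
        simp [signedCross, frameMap]; ring
      rw [this]; positivity

theorem volume_triangle {A B C : Plane} (h : 0 < signedCross A B C) :
    volume (triangle A B C) = ENNReal.ofReal (signedCross A B C / 2) := by
  have : triangle A B C = (fun x => A + x) '' (frameMap (B - A) (C - A) '' unitTriangle) := by
    ext x
    rw [mem_triangle_iff h, Set.image_image]
    rfl
  rw [this, Set.image_add_left, measure_preimage_add, Measure.addHaar_image_linearMap,
    volume_unitTriangle, det_frameMap, ← ENNReal.ofReal_mul (abs_nonneg _)]
  congr 1
  have e : (B - A) 0 * (C - A) 1 - (B - A) 1 * (C - A) 0 = signedCross A B C := by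
    simp [signedCross]
  rw [e, abs_of_pos h]
  ring

theorem triangle_subset_of_convex {A B C : Plane} (h : 0 < signedCross A B C) {s : Set Plane}
    (hs : Convex ℝ s) (hA : A ∈ s) (hB : B ∈ s) (hC : C ∈ s) : triangle A B C ⊆ s := by
  intro x hx
  obtain ⟨p, ⟨h0, h1, h2⟩, rfl⟩ := (mem_triangle_iff h x).1 hx
  have : A + frameMap (B - A) (C - A) p =
      ∑ i, (![1 - p 0 - p 1, p 0, p 1] i) • (![A, B, C] i) := by
    simp only [frameMap, Fin.sum_univ_three, LinearMap.coe_mk, AddHom.coe_mk]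
    simp
    module
  rw [this]
  apply hs.sum_mem
  · intro i _
    fin_cases i
    · simpa using by linarith
    · exact h0
    · exact h1
  · simp [Fin.sum_univ_three]
    ring
  · intro i _
    fin_cases i <;> assumption

theorem volume_signedCross_eq_zero {A B C : Plane} (h : signedCross A B C ≠ 0) :
    volume {x | signedCross A B x = 0} = 0 := by
  let s : AffineSubspace ℝ Plane :=
    { carrier := {x | signedCross A B x = 0}
      smul_vsub_vadd_mem' := by
        intro c p q r hp hq hr
        simp only [Set.mem_ofPred_eq, signedCross, vsub_eq_sub, vadd_eq_add, PiLp.add_apply,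
          PiLp.smul_apply, PiLp.sub_apply, smul_eq_mul] at hp hq hr ⊢
        linear_combination c * hp - c * hq + hr }
  refine Measure.addHaar_affineSubspace volume s fun hs => h ?_
  have : C ∈ s := hs ▸ AffineSubspace.mem_top ℝ Plane C
  exact this

theorem convexHull_subset_signedCross_nonneg {V : Fin 4 → Plane}
    (h : ∀ i, 0 < signedCross (V i) (V (i + 1)) (V (i + 2))) (i : Fin 4) :
    convexHull ℝ (Set.range V) ⊆ {x | 0 ≤ signedCross (V i) (V (i + 1)) x} := by
  refine convexHull_min ?_ (convex_signedCross_nonneg _ _)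
  rintro _ ⟨j, rfl⟩
  have h0 := h i
  have h1 := h (i + 3)
  obtain ⟨k, rfl⟩ : ∃ k, j = i + k := ⟨j - i, by simp⟩
  have e1 : i + 3 + 1 = i := by rw [add_assoc]; simp
  have e2 : i + 3 + 2 = i + 1 := by rw [add_assoc]; rfl
  rw [e1, e2] at h1
  simp only [Set.mem_ofPred_eq]
  -- Offsets 0 and 1 lie on the side itself, offset 2 is the turn at `i`, and offset 3 is the turn
  -- at `i + 3` with its vertices cyclically permuted.
  fin_cases k
  · simp [signedCross]
  · simp [signedCross, mul_comm ((V (i + 1)) 0 - _)]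
  · exact h0.le
  · simp only [signedCross] at h1 ⊢
    simp
    linarith

/-- A point to the left of all four sides lies in one of the two triangles, according to its side of
the diagonal `V 0`, `V 2`. -/
theorem convexHull_eq_union_triangle {V : Fin 4 → Plane}
    (h : ∀ i, 0 < signedCross (V i) (V (i + 1)) (V (i + 2))) :
    convexHull ℝ (Set.range V) = triangle (V 0) (V 1) (V 2) ∪ triangle (V 2) (V 3) (V 0) := by
  apply Set.Subset.antisymm
  · intro x hx
    have H i : 0 ≤ signedCross (V i) (V (i + 1)) x := convexHull_subset_signedCross_nonneg h i hx
    rcases le_total 0 (signedCross (V 2) (V 0) x) with h2 | h2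
    · exact Or.inl ⟨H 0, H 1, h2⟩
    · refine Or.inr ⟨H 2, H 3, ?_⟩
      simp only [signedCross] at h2 ⊢
      linarith
  · have hV i : V i ∈ convexHull ℝ (Set.range V) := subset_convexHull ℝ _ ⟨i, rfl⟩
    exact Set.union_subset
      (triangle_subset_of_convex (h 0) (convex_convexHull ℝ _) (hV 0) (hV 1) (hV 2))
      (triangle_subset_of_convex (h 2) (convex_convexHull ℝ _) (hV 2) (hV 3) (hV 0))

theorem isClosed_triangle (A B C : Plane) : IsClosed (triangle A B C) := by
  have hc (P Q : Plane) : Continuous fun x => signedCross P Q x := by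
    unfold signedCross
    fun_prop
  exact (isClosed_le continuous_const (hc A B)).inter
    ((isClosed_le continuous_const (hc B C)).inter (isClosed_le continuous_const (hc C A)))

theorem area_convexHull {V : Fin 4 → Plane}
    (h : ∀ i, 0 < signedCross (V i) (V (i + 1)) (V (i + 2))) :
    area (convexHull ℝ (Set.range V)) =
      (signedCross (V 0) (V 1) (V 2) + signedCross (V 2) (V 3) (V 0)) / 2 := by
  have h0 : 0 < signedCross (V 0) (V 1) (V 2) := h 0
  have h2 : 0 < signedCross (V 2) (V 3) (V 0) := h 2
  have hnull : AEDisjoint volume (triangle (V 0) (V 1) (V 2)) (triangle (V 2) (V 3) (V 0)) := by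
    refine measure_mono_null (t := {x | signedCross (V 0) (V 2) x = 0}) ?_
      (volume_signedCross_eq_zero (C := V 1) ?_)
    · rintro x ⟨⟨-, -, hx⟩, -, -, hx'⟩
      simp only [signedCross, Set.mem_ofPred_eq] at hx hx' ⊢
      linarith
    · simp only [signedCross] at h0 ⊢
      intro h
      linarith
  rw [area, convexHull_eq_union_triangle h,
    measure_union₀ (isClosed_triangle _ _ _).measurableSet.nullMeasurableSet hnull,
    volume_triangle h0, volume_triangle h2, ← ENNReal.ofReal_add (by positivity) (by positivity),
    ENNReal.toReal_ofReal (by positivity)]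
  ring

/-! ### Quadrilaterals circumscribed about the unit circle -/

/-- Among positive reals with equal first and third elementary symmetric functions, the sum is at
least `4`, with equality only if all are equal to `1`. -/
theorem four_le_sum_of_esymm_eq {a b c d : ℝ} (ha : 0 < a) (hb : 0 < b) (hc : 0 < c) (hd : 0 < d)
    (h : a + b + c + d = a * b * c + a * b * d + a * c * d + b * c * d) :
    4 ≤ a + b + c + d ∧ (a + b + c + d = 4 → a = 1 ∧ b = 1 ∧ c = 1 ∧ d = 1) := by
  -- Write the third symmetric function as `a b (c + d) + c d (a + b)` and complete squares: first
  -- in each pair, then between the pair sums.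
  have key : (a + b + c + d) ^ 3 - 16 * (a + b + c + d) =
      4 * (c + d) * (a - b) ^ 2 + 4 * (a + b) * (c - d) ^ 2 +
        (a + b + c + d) * (a + b - c - d) ^ 2 := by
    linear_combination -16 * h
  have h1 : 0 ≤ (c + d) * (a - b) ^ 2 := by positivity
  have h2 : 0 ≤ (a + b) * (c - d) ^ 2 := by positivity
  have h3 : 0 ≤ (a + b + c + d) * (a + b - c - d) ^ 2 := by positivity
  have hs : 0 < a + b + c + d := by positivity
  constructor
  · by_contra! hlt
    nlinarith [mul_pos hs (mul_pos (sub_pos.2 hlt) (by linarith : 0 < 4 + (a + b + c + d)))]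
  · intro h4
    have hz : (a + b + c + d) ^ 3 - 16 * (a + b + c + d) = 0 := by rw [h4]; norm_num
    have z1 : (c + d) * (a - b) ^ 2 = 0 := by linarith
    have z2 : (a + b) * (c - d) ^ 2 = 0 := by linarith
    have z3 : (a + b + c + d) * (a + b - c - d) ^ 2 = 0 := by linarith
    have w1 : a - b = 0 := by simpa [(add_pos hc hd).ne'] using z1
    have w2 : c - d = 0 := by simpa [(add_pos ha hb).ne'] using z2
    have w3 : a + b - c - d = 0 := by simpa [hs.ne'] using z3
    refine ⟨?_, ?_, ?_, ?_⟩ <;> linarith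

/-- `t i` is the tangent length at the vertex `V i` of a quadrilateral circumscribed about the
unit circle, whose side from `V i` to `V (i + 1)` touches the circle at `u i`. -/
def IsTangentLengths (V u : Fin 4 → Plane) (t : Fin 4 → ℝ) : Prop :=
  ∀ i, 0 < t i ∧ u i 0 ^ 2 + u i 1 ^ 2 = 1 ∧
    V i 0 = u i 0 + t i * u i 1 ∧ V i 1 = u i 1 - t i * u i 0 ∧
    V (i + 1) 0 = u i 0 - t (i + 1) * u i 1 ∧ V (i + 1) 1 = u i 1 + t (i + 1) * u i 0

/-- Each side lies on the line of points having inner product `1` with `u i`, so its endpoints are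
`u i` moved along the tangent. The signs come from the centre lying to the left of every side. -/
theorem exists_isTangentLengths {V u : Fin 4 → Plane}
    (hV : ∀ i, 0 < signedCross (V i) (V (i + 1)) (V (i + 2)))
    (h0 : 0 ∈ convexHull ℝ (Set.range V))
    (hu : ∀ i, u i ∈ segment ℝ (V i) (V (i + 1)))
    (hn : ∀ i, u i 0 ^ 2 + u i 1 ^ 2 = 1)
    (ho : ∀ i, u i 0 * (V (i + 1) 0 - V i 0) + u i 1 * (V (i + 1) 1 - V i 1) = 0) :
    ∃ t, IsTangentLengths V u t := by
  have e1 : ∀ i : Fin 4, i + 3 + 1 = i := by decide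
  have e2 : ∀ i : Fin 4, i + 3 + 2 = i + 1 := by decide
  let s : Fin 4 → ℝ := fun i => V i 0 * u i 1 - V i 1 * u i 0
  let r : Fin 4 → ℝ := fun i => u i 0 * V (i + 1) 1 - u i 1 * V (i + 1) 0
  have side : ∀ i, 0 ≤ s i ∧ 0 ≤ r i ∧ V i 0 = u i 0 + s i * u i 1 ∧
      V i 1 = u i 1 - s i * u i 0 ∧ V (i + 1) 0 = u i 0 - r i * u i 1 ∧
      V (i + 1) 1 = u i 1 + r i * u i 0 := by
    intro i
    have hc : 0 ≤ V i 0 * V (i + 1) 1 - V i 1 * V (i + 1) 0 := by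
      have := convexHull_subset_signedCross_nonneg hV i h0
      simp only [signedCross, Set.mem_ofPred_eq, PiLp.zero_apply] at this
      linarith
    obtain ⟨a, b, ha, hb, hab, hx⟩ := hu i
    have x0 : u i 0 = a * V i 0 + b * V (i + 1) 0 := by rw [← hx]; simp
    have x1 : u i 1 = a * V i 1 + b * V (i + 1) 1 := by rw [← hx]; simp
    have d1 : u i 0 * V i 0 + u i 1 * V i 1 = 1 := by
      linear_combination hn i - u i 0 * x0 - u i 1 * x1 - (u i 0 * V i 0 + u i 1 * V i 1) * hab
        - b * ho i
    have d2 : u i 0 * V (i + 1) 0 + u i 1 * V (i + 1) 1 = 1 := by linear_combination ho i + d1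
    refine ⟨?_, ?_, ?_, ?_, ?_, ?_⟩
    · have : s i = b * (V i 0 * V (i + 1) 1 - V i 1 * V (i + 1) 0) := by
        simp only [s]; rw [x0, x1]; ring
      rw [this]; positivity
    · have : r i = a * (V i 0 * V (i + 1) 1 - V i 1 * V (i + 1) 0) := by
        simp only [r]; rw [x0, x1]; ring
      rw [this]; positivity
    · simp only [s]
      linear_combination u i 0 * d1 - V i 0 * hn i
    · simp only [s]
      linear_combination u i 1 * d1 - V i 1 * hn i
    · simp only [r]
      linear_combination u i 0 * d2 - V (i + 1) 0 * hn i
    · simp only [r]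
      linear_combination u i 1 * d2 - V (i + 1) 1 * hn i
  -- Pythagoras: both tangent lengths at a vertex have square `|V (i + 1)| ^ 2 - 1`.
  have hrs : ∀ i, r i = s (i + 1) := by
    intro i
    obtain ⟨-, hr, -, -, a0, a1⟩ := side i
    obtain ⟨hs, -, b0, b1, -, -⟩ := side (i + 1)
    have q1 : V (i + 1) 0 ^ 2 + V (i + 1) 1 ^ 2 = 1 + r i ^ 2 := by
      rw [a0, a1]; linear_combination (1 + r i ^ 2) * hn i
    have q2 : V (i + 1) 0 ^ 2 + V (i + 1) 1 ^ 2 = 1 + s (i + 1) ^ 2 := by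
      rw [b0, b1]; linear_combination (1 + s (i + 1) ^ 2) * hn (i + 1)
    exact (sq_eq_sq₀ hr hs).1 (by linarith)
  refine ⟨s, fun i => ?_⟩
  obtain ⟨hs, hr, a0, a1, b0, b1⟩ := side i
  rw [hrs i] at b0 b1
  -- If a tangent length vanishes, the two sides at that vertex touch the circle at the same point,
  -- hence share a tangent line, and three consecutive vertices are collinear. Index `i + 3` is the
  -- predecessor of `i`.
  refine ⟨lt_of_le_of_ne hs fun hz => ?_, hn i, a0, a1, b0, b1⟩
  obtain ⟨-, -, c0, c1, d0, d1⟩ := side (i + 3)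
  have hp := hV (i + 3)
  rw [hrs (i + 3)] at d0 d1
  rw [e1] at d0 d1
  rw [e1, e2] at hp
  rw [← hz] at a0 a1 d0 d1
  have f0 : u (i + 3) 0 = u i 0 := by linarith
  have f1 : u (i + 3) 1 = u i 1 := by linarith
  rw [f0, f1] at c0 c1
  rw [signedCross, a0, a1, b0, b1, c0, c1] at hp
  apply hp.ne'
  ring

namespace IsTangentLengths

variable {V u : Fin 4 → Plane} {t : Fin 4 → ℝ}

theorem esymm_eq (h : IsTangentLengths V u t) :
    t 0 + t 1 + t 2 + t 3 =
      t 0 * t 1 * t 2 + t 0 * t 1 * t 3 + t 0 * t 2 * t 3 + t 1 * t 2 * t 3 := by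
  let z : Fin 4 → ℂ := fun i => ⟨V i 0, V i 1⟩
  -- As complex numbers, `V i = u i (1 - t i I)` and `V (i + 1) = u i (1 + t (i + 1) I)`; eliminate
  -- `u i`. In the product of the four relations the vertices cancel, and the imaginary part is the
  -- claim.
  have step : ∀ i, (1 - t i * Complex.I) * z (i + 1) = (1 + t (i + 1) * Complex.I) * z i := by
    intro i
    obtain ⟨-, -, a0, a1, b0, b1⟩ := h i
    apply Complex.ext
    · simp [z]
      rw [a0, a1, b0, b1]; ring
    · simp [z]
      rw [a0, a1, b0, b1]; ring
  have hz : ∀ i, z i ≠ 0 := by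
    intro i hi
    obtain ⟨ht, hn, a0, a1, -, -⟩ := h i
    have z0 : V i 0 = 0 := congrArg Complex.re hi
    have z1 : V i 1 = 0 := congrArg Complex.im hi
    have : V i 0 ^ 2 + V i 1 ^ 2 = 1 + t i ^ 2 := by
      rw [a0, a1]; linear_combination (1 + t i ^ 2) * hn
    rw [z0, z1] at this
    nlinarith
  have s0 : (1 - t 0 * Complex.I) * z 1 = (1 + t 1 * Complex.I) * z 0 := step 0
  have s1 : (1 - t 1 * Complex.I) * z 2 = (1 + t 2 * Complex.I) * z 1 := step 1
  have s2 : (1 - t 2 * Complex.I) * z 3 = (1 + t 3 * Complex.I) * z 2 := step 2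
  have s3 : (1 - t 3 * Complex.I) * z 0 = (1 + t 0 * Complex.I) * z 3 := step 3
  have hprod : (1 - t 0 * Complex.I) * (1 - t 1 * Complex.I) * (1 - t 2 * Complex.I) *
      (1 - t 3 * Complex.I) = (1 + t 0 * Complex.I) * (1 + t 1 * Complex.I) *
      (1 + t 2 * Complex.I) * (1 + t 3 * Complex.I) := by
    have hne : z 0 * z 1 * z 2 * z 3 ≠ 0 :=
      mul_ne_zero (mul_ne_zero (mul_ne_zero (hz 0) (hz 1)) (hz 2)) (hz 3)
    apply mul_right_cancel₀ hne
    calc _ = ((1 - t 0 * Complex.I) * z 1) * ((1 - t 1 * Complex.I) * z 2) *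
          ((1 - t 2 * Complex.I) * z 3) * ((1 - t 3 * Complex.I) * z 0) := by ring
      _ = _ := by rw [s0, s1, s2, s3]; ring
  have him := congrArg Complex.im hprod
  simp at him
  linarith

theorem area_eq (h : IsTangentLengths V u t)
    (hV : ∀ i, 0 < signedCross (V i) (V (i + 1)) (V (i + 2))) :
    area (convexHull ℝ (Set.range V)) = t 0 + t 1 + t 2 + t 3 := by
  -- Twice the area of the triangle from the centre to a side: height `1`, base `t i + t (i + 1)`.
  have hc : ∀ i, V i 0 * V (i + 1) 1 - V i 1 * V (i + 1) 0 = t i + t (i + 1) := by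
    intro i
    obtain ⟨-, hn, a0, a1, b0, b1⟩ := h i
    rw [a0, a1, b0, b1]
    linear_combination (t i + t (i + 1)) * hn
  have c0 : V 0 0 * V 1 1 - V 0 1 * V 1 0 = t 0 + t 1 := hc 0
  have c1 : V 1 0 * V 2 1 - V 1 1 * V 2 0 = t 1 + t 2 := hc 1
  have c2 : V 2 0 * V 3 1 - V 2 1 * V 3 0 = t 2 + t 3 := hc 2
  have c3 : V 3 0 * V 0 1 - V 3 1 * V 0 0 = t 3 + t 0 := hc 3
  rw [area_convexHull hV, signedCross, signedCross]
  linear_combination (c0 + c1 + c2 + c3) / 2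

theorem four_le_sum (h : IsTangentLengths V u t) : 4 ≤ t 0 + t 1 + t 2 + t 3 :=
  (four_le_sum_of_esymm_eq (h 0).1 (h 1).1 (h 2).1 (h 3).1 h.esymm_eq).1

theorem eq_one_of_sum_eq (h : IsTangentLengths V u t) (hs : t 0 + t 1 + t 2 + t 3 = 4)
    (i : Fin 4) : t i = 1 := by
  obtain ⟨h0, h1, h2, h3⟩ :=
    (four_le_sum_of_esymm_eq (h 0).1 (h 1).1 (h 2).1 (h 3).1 h.esymm_eq).2 hs
  fin_cases i <;> assumption

theorem sum_eq_of_midpoint (h : IsTangentLengths V u t)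
    (hm : ∀ i, u i = midpoint ℝ (V i) (V (i + 1))) : t 0 + t 1 + t 2 + t 3 = 4 := by
  have step : ∀ i, t (i + 1) = t i := by
    intro i
    obtain ⟨-, hn, a0, a1, b0, b1⟩ := h i
    have m0 : u i 0 = (V i 0 + V (i + 1) 0) / 2 := by
      conv_lhs => rw [hm i]
      simp [midpoint_eq_smul_add]; ring
    have m1 : u i 1 = (V i 1 + V (i + 1) 1) / 2 := by
      conv_lhs => rw [hm i]
      simp [midpoint_eq_smul_add]; ring
    rw [a0, b0] at m0
    rw [a1, b1] at m1
    linear_combination (t i - t (i + 1)) * hn + 2 * u i 1 * m0 - 2 * u i 0 * m1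
  have h1 : t 1 = t 0 := step 0
  have h2 : t 2 = t 1 := step 1
  have h3 : t 3 = t 2 := step 2
  have he := h.esymm_eq
  rw [h3, h2, h1] at he ⊢
  have ht := (h 0).1
  have : t 0 * (t 0 - 1) * (t 0 + 1) = 0 := by linear_combination -he / 4
  have h' : t 0 - 1 = 0 := by
    rcases mul_eq_zero.1 this with h' | h'
    · exact (mul_eq_zero.1 h').resolve_left ht.ne'
    · linarith
  linarith

theorem eq_midpoint (h : IsTangentLengths V u t) (ht : ∀ i, t i = 1) (i : Fin 4) :
    u i = midpoint ℝ (V i) (V (i + 1)) := by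
  obtain ⟨-, hn, a0, a1, b0, b1⟩ := h i
  rw [ht] at a0 a1 b0 b1
  apply Plane.ext
  · simp [midpoint_eq_smul_add]; rw [a0, b0]; ring
  · simp [midpoint_eq_smul_add]; rw [a1, b1]; ring

theorem sub_eq_neg_sub (h : IsTangentLengths V u t) (ht : ∀ i, t i = 1) (i : Fin 4) :
    V (i + 1) - V i = -(V (i + 3) - V (i + 2)) := by
  -- With unit tangent lengths, a quarter turn about the centre takes each vertex to the next.
  have rot : ∀ i, V (i + 1) 0 = -V i 1 ∧ V (i + 1) 1 = V i 0 := by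
    intro i
    obtain ⟨-, hn, a0, a1, b0, b1⟩ := h i
    rw [ht] at a0 a1 b0 b1
    constructor <;> linarith
  obtain ⟨p0, p1⟩ := rot i
  obtain ⟨q0, q1⟩ := rot (i + 1)
  obtain ⟨r0, r1⟩ := rot (i + 2)
  have e1 : i + 1 + 1 = i + 2 := by rw [add_assoc]; rfl
  have e2 : i + 2 + 1 = i + 3 := by rw [add_assoc]; rfl
  rw [e1] at q0 q1
  rw [e2] at r0 r1
  apply Plane.ext <;> simp <;> linarith

end IsTangentLengths

/-! ### Affine changes of coordinates -/

theorem area_image_affineEquiv (T : Plane ≃ᵃ[ℝ] Plane) (s : Set Plane) :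
    area (T '' s) = |LinearMap.det (T.linear : Plane →ₗ[ℝ] Plane)| * area s := by
  have : T '' s = (fun x => T 0 + x) '' ((T.linear : Plane →ₗ[ℝ] Plane) '' s) := by
    rw [Set.image_image]
    refine Set.image_congr fun x _ => ?_
    have := T.map_vadd 0 x
    simp only [vadd_eq_add, add_zero] at this
    rw [this, add_comm]
    rfl
  rw [area, this, Set.image_add_left, measure_preimage_add, Measure.addHaar_image_linearMap,
    ENNReal.toReal_mul, ENNReal.toReal_ofReal (abs_nonneg _), area]

theorem area_image_div_area_image (T : Plane ≃ᵃ[ℝ] Plane) (s s' : Set Plane) :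
    area (T '' s) / area (T '' s') = area s / area s' := by
  rw [area_image_affineEquiv, area_image_affineEquiv]
  exact mul_div_mul_left _ _ (abs_ne_zero.2 T.linear.isUnit_det'.ne_zero)

theorem area_unitDisk : area {x : Plane | x 0 ^ 2 + x 1 ^ 2 ≤ 1} = Real.pi := by
  have : {x : Plane | x 0 ^ 2 + x 1 ^ 2 ≤ 1} = Metric.closedBall 0 1 := by
    ext x
    rw [mem_closedBall_zero_iff, EuclideanSpace.norm_eq, Real.sqrt_le_one]
    simp
  rw [area, this, EuclideanSpace.volume_closedBall_fin_two]
  simp [Real.pi_pos.le]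

/-- Scaling the coordinates by `a` and `b`. -/
noncomputable def scaleEquiv {a b : ℝ} (ha : a ≠ 0) (hb : b ≠ 0) : Plane ≃ₗ[ℝ] Plane where
  toFun x := !₂[a * x 0, b * x 1]
  invFun x := !₂[x 0 / a, x 1 / b]
  map_add' x y := by apply Plane.ext <;> simp <;> ring
  map_smul' c x := by apply Plane.ext <;> simp <;> ring
  left_inv x := by apply Plane.ext <;> simp <;> field_simp
  right_inv x := by apply Plane.ext <;> simp <;> field_simp

/-- Scale by the semi-axes, rotate into the axis frame, translate to the centre. -/
theorem Ellipse.exists_form_affineEquiv (E : Ellipse) :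
    ∃ T : Plane ≃ᵃ[ℝ] Plane, ∀ x, E.form (T x) = x 0 ^ 2 + x 1 ^ 2 := by
  refine ⟨((scaleEquiv E.a_pos.ne' E.b_pos.ne').trans
    E.axes.repr.symm.toLinearEquiv).toAffineEquiv.trans
      (AffineEquiv.constVAdd ℝ Plane E.center), fun x => ?_⟩
  have ha := E.a_pos.ne'
  have hb := E.b_pos.ne'
  simp [Ellipse.form, scaleEquiv]
  field_simp

/-- Exchanging the coordinates. -/
def swapEquiv : Plane ≃ₗ[ℝ] Plane where
  toFun x := !₂[x 1, x 0]
  invFun x := !₂[x 1, x 0]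
  map_add' x y := by apply Plane.ext <;> simp
  map_smul' c x := by apply Plane.ext <;> simp
  left_inv x := by apply Plane.ext <;> simp
  right_inv x := by apply Plane.ext <;> simp

/-! ### Convexity and tangency in coordinates -/

theorem signedCross_eq_zero_of_mem {A B p : Plane} (hp : p ∈ affineSpan ℝ {A, B}) :
    signedCross A B p = 0 := by
  obtain ⟨c, rfl⟩ := mem_affineSpan_pair_iff_exists_lineMap_eq.1 hp
  simp [signedCross, AffineMap.lineMap_apply]
  ring

theorem mem_of_signedCross_eq_zero {A B p : Plane} (hAB : A ≠ B) (h : signedCross A B p = 0) :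
    p ∈ affineSpan ℝ {A, B} := by
  rw [mem_affineSpan_pair_iff_exists_lineMap_eq]
  simp only [signedCross] at h
  by_cases h0 : B 0 - A 0 = 0
  · have h1 : B 1 - A 1 ≠ 0 := fun h1 => hAB (Plane.ext (by linarith) (by linarith))
    refine ⟨(p 1 - A 1) / (B 1 - A 1), ?_⟩
    apply Plane.ext <;> simp [AffineMap.lineMap_apply] <;> field_simp <;> linarith
  · refine ⟨(p 0 - A 0) / (B 0 - A 0), ?_⟩
    apply Plane.ext <;> simp [AffineMap.lineMap_apply] <;> field_simp <;> linarith

theorem signedCross_mul_pos {A B x y : Plane} (hAB : A ≠ B)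
    (h : (affineSpan ℝ {A, B}).SSameSide x y) :
    0 < signedCross A B x * signedCross A B y := by
  obtain ⟨⟨p, hp, q, hq, hr⟩, hx, hy⟩ := h
  have hx' : signedCross A B x ≠ 0 := fun h => hx (mem_of_signedCross_eq_zero hAB h)
  have hy' : signedCross A B y ≠ 0 := fun h => hy (mem_of_signedCross_eq_zero hAB h)
  have hpz := signedCross_eq_zero_of_mem hp
  have hqz := signedCross_eq_zero_of_mem hq
  have hxp : x -ᵥ p ≠ 0 := fun h => hx (by rwa [vsub_eq_zero_iff_eq.1 h])
  have hyq : y -ᵥ q ≠ 0 := fun h => hy (by rwa [vsub_eq_zero_iff_eq.1 h])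
  obtain ⟨r, s, hr0, hs0, hrs⟩ := hr.exists_pos hxp hyq
  have e0 : r * (x 0 - p 0) = s * (y 0 - q 0) := by simpa using congrArg (fun v : Plane => v 0) hrs
  have e1 : r * (x 1 - p 1) = s * (y 1 - q 1) := by simpa using congrArg (fun v : Plane => v 1) hrs
  have key : r * signedCross A B x = s * signedCross A B y := by
    simp only [signedCross] at hpz hqz ⊢
    linear_combination (B 0 - A 0) * e1 - (B 1 - A 1) * e0 + r * hpz - s * hqz
  have : r * (signedCross A B x * signedCross A B y) = s * signedCross A B y ^ 2 := by
    linear_combination signedCross A B y * key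
  have hpos : 0 < r * (signedCross A B x * signedCross A B y) := by rw [this]; positivity
  exact (mul_pos_iff_of_pos_left hr0).1 hpos

theorem Polygon.IsConvexQuadrilateral.ne {D : Polygon Plane 4} (hD : D.IsConvexQuadrilateral)
    (i : Fin 4) : D i ≠ D (i + 1) := by
  intro h
  have e : ∀ i : Fin 4, i + 1 + 3 = i := by decide
  have := (hD (i + 1)).2.2
  rw [e, h] at this
  exact this (left_mem_affineSpan_pair ℝ _ _)

theorem Polygon.map_sideLine (T : Plane ≃ᵃ[ℝ] Plane) (V : Polygon Plane 4) (i : Fin 4) :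
    (V.sideLine i).map (T : Plane →ᵃ[ℝ] Plane) =
      (Polygon.mk (T ∘ V.vertices)).sideLine i := by
  simp [Polygon.sideLine, AffineSubspace.map_span, Set.image_pair]

theorem Polygon.isConvexQuadrilateral_comp_iff (T : Plane ≃ᵃ[ℝ] Plane) (V : Polygon Plane 4) :
    (Polygon.mk (T ∘ V.vertices)).IsConvexQuadrilateral ↔ V.IsConvexQuadrilateral := by
  refine forall_congr' fun i => ?_
  rw [← Polygon.map_sideLine]
  exact T.sSameSide_map_iff

/-- The same-side condition for one side says that the turns at its two ends have equal sign; this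
sign propagates around the quadrilateral. -/
theorem Polygon.IsConvexQuadrilateral.signedCross_pos_or_neg {V : Polygon Plane 4}
    (hV : V.IsConvexQuadrilateral) :
    (∀ i, 0 < signedCross (V i) (V (i + 1)) (V (i + 2))) ∨
      ∀ i, signedCross (V i) (V (i + 1)) (V (i + 2)) < 0 := by
  have h : ∀ i, 0 < signedCross (V i) (V (i + 1)) (V (i + 2)) *
      signedCross (V (i + 3)) (V i) (V (i + 1)) := by
    intro i
    have := signedCross_mul_pos (hV.ne i) (hV i)
    convert this using 2
    simp only [signedCross]
    ring
  have h1 : 0 < signedCross (V 1) (V 2) (V 3) * signedCross (V 0) (V 1) (V 2) := h 1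
  have h2 : 0 < signedCross (V 2) (V 3) (V 0) * signedCross (V 1) (V 2) (V 3) := h 2
  have h3 : 0 < signedCross (V 3) (V 0) (V 1) * signedCross (V 2) (V 3) (V 0) := h 3
  rcases mul_pos_iff.1 h1 with ⟨p1, p0⟩ | ⟨p1, p0⟩
  · left
    have p2 := (mul_pos_iff_of_pos_right p1).1 h2
    have p3 := (mul_pos_iff_of_pos_right p2).1 h3
    intro i
    fin_cases i <;> assumption
  · right
    have p2 := neg_of_mul_pos_left h2 p1.le
    have p3 := neg_of_mul_pos_left h3 p2.le
    intro i
    fin_cases i <;> assumption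

/-- A line meeting the unit circle only at `u` is orthogonal to `u`. -/
theorem orthogonal_of_inter_unitCircle {A B u : Plane} (hAB : A ≠ B)
    (h : (affineSpan ℝ {A, B} : Set Plane) ∩ {x | x 0 ^ 2 + x 1 ^ 2 = 1} = {u}) :
    u 0 * (B 0 - A 0) + u 1 * (B 1 - A 1) = 0 := by
  have hu : u ∈ (affineSpan ℝ {A, B} : Set Plane) ∩ {x | x 0 ^ 2 + x 1 ^ 2 = 1} := by
    rw [h]; rfl
  obtain ⟨hl, hc⟩ := hu
  rw [Set.mem_ofPred_eq] at hc
  have hn : 0 < (B 0 - A 0) ^ 2 + (B 1 - A 1) ^ 2 := by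
    by_contra! hle
    refine hAB (Plane.ext ?_ ?_) <;> nlinarith [sq_nonneg (B 0 - A 0), sq_nonneg (B 1 - A 1)]
  set c := u 0 * (B 0 - A 0) + u 1 * (B 1 - A 1) with hcdef
  set n := (B 0 - A 0) ^ 2 + (B 1 - A 1) ^ 2 with hndef
  have hn' := hn.ne'
  -- This is the other root of the quadratic for the line meeting the circle; it must coincide with
  -- `u`, so `c = 0`.
  have hmem : (-2 * c / n) • (B - A) + u ∈
      (affineSpan ℝ {A, B} : Set Plane) ∩ {x | x 0 ^ 2 + x 1 ^ 2 = 1} := by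
    constructor
    · exact AffineSubspace.vadd_mem_of_mem_direction (Submodule.smul_mem _ _
        (AffineSubspace.vsub_mem_direction (right_mem_affineSpan_pair ℝ A B)
          (left_mem_affineSpan_pair ℝ A B))) hl
    · have hk : (-2 * c / n) * n = -2 * c := by field_simp
      simp only [Set.mem_ofPred_eq, PiLp.add_apply, PiLp.smul_apply, PiLp.sub_apply, smul_eq_mul]
      generalize -2 * c / n = k at hk
      linear_combination hc + k * hk - k ^ 2 * hndef - 2 * k * hcdef
  rw [h, Set.mem_singleton_iff, add_eq_right, smul_eq_zero] at hmem
  rcases hmem with hk | hk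
  · field_simp at hk
    simpa using hk
  · exact absurd (sub_eq_zero.1 hk).symm hAB

theorem Ellipse.TangentAt.eq {E : Ellipse} {l : AffineSubspace ℝ Plane} {p q : Plane}
    (hp : E.TangentAt l p) (hq : E.TangentAt l q) : p = q :=
  Set.singleton_injective (hp.symm.trans hq)

/-! ### The area ratio and the equality case -/

/-- The theorem in coordinates in which the ellipse is the unit circle and the quadrilateral is
positively oriented. -/
theorem area_ratio_of_form_eq {E : Ellipse} {T : Plane ≃ᵃ[ℝ] Plane}
    (hT : ∀ x, E.form (T x) = x 0 ^ 2 + x 1 ^ 2) {V : Polygon Plane 4}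
    (hV : ∀ i, 0 < signedCross (V i) (V (i + 1)) (V (i + 2)))
    (hne : ∀ i, V i ≠ V (i + 1)) (hE : E.InscribedIn (Polygon.mk (T ∘ V.vertices))) :
    area E.region / area (Polygon.mk (T ∘ V.vertices)).region ≤ Real.pi / 4 ∧
      (area E.region / area (Polygon.mk (T ∘ V.vertices)).region = Real.pi / 4 ↔
        (Polygon.mk (T ∘ V.vertices)).IsParallelogram ∧
          E.TangentAtMidpoints (Polygon.mk (T ∘ V.vertices))) := by
  have hreg : E.region = T '' {x : Plane | x 0 ^ 2 + x 1 ^ 2 ≤ 1} := by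
    ext y
    obtain ⟨x, rfl⟩ := T.surjective y
    rw [T.injective.mem_set_image]
    simp [Ellipse.region, hT]
  have hcur : E.curve = T '' {x : Plane | x 0 ^ 2 + x 1 ^ 2 = 1} := by
    ext y
    obtain ⟨x, rfl⟩ := T.surjective y
    rw [T.injective.mem_set_image]
    simp [Ellipse.curve, hT]
  have hDreg : (Polygon.mk (T ∘ V.vertices)).region = T '' convexHull ℝ (Set.range V.vertices) := by
    rw [Polygon.region, Set.range_comp]
    exact ((T : Plane →ᵃ[ℝ] Plane).image_convexHull _).symm
  have hratio : area E.region / area (Polygon.mk (T ∘ V.vertices)).region =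
      Real.pi / area (convexHull ℝ (Set.range V.vertices)) := by
    rw [hreg, hDreg, area_image_div_area_image, area_unitDisk]
  obtain ⟨hsub, htan⟩ := hE
  choose q hqs hqt using htan
  let u : Fin 4 → Plane := fun i => T.symm (q i)
  have hTu : ∀ i, T (u i) = q i := fun i => T.apply_symm_apply (q i)
  have hu : ∀ i, u i ∈ segment ℝ (V i) (V (i + 1)) := by
    intro i
    have h := hqs i
    have him := image_segment ℝ (T : Plane →ᵃ[ℝ] Plane) (V i) (V (i + 1))
    have h' : T (u i) ∈ T '' segment ℝ (V i) (V (i + 1)) := by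
      rw [hTu]
      exact him ▸ h
    exact (T.injective.mem_set_image).1 h'
  have hint : ∀ i, (affineSpan ℝ {V i, V (i + 1)} : Set Plane) ∩ {x | x 0 ^ 2 + x 1 ^ 2 = 1} =
      {u i} := by
    intro i
    have h := hqt i
    rw [Ellipse.TangentAt, ← Polygon.map_sideLine, AffineSubspace.coe_map, hcur, ← hTu] at h
    apply T.injective.image_injective
    rw [Set.image_inter T.injective, Set.image_singleton]
    exact h
  have hn : ∀ i, u i 0 ^ 2 + u i 1 ^ 2 = 1 := fun i => by
    have : u i ∈ (affineSpan ℝ {V i, V (i + 1)} : Set Plane) ∩ {x | x 0 ^ 2 + x 1 ^ 2 = 1} := by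
      rw [hint i]; rfl
    exact this.2
  -- The origin corresponds to the centre of `E`, which lies in the quadrilateral because the region
  -- of `E` does.
  have h0 : (0 : Plane) ∈ convexHull ℝ (Set.range V.vertices) := by
    rw [← T.injective.mem_set_image, ← hDreg]
    apply hsub
    rw [hreg, T.injective.mem_set_image]
    simp
  obtain ⟨t, ht⟩ := exists_isTangentLengths hV h0 hu hn
    fun i => orthogonal_of_inter_unitCircle (hne i) (hint i)
  have h4 := ht.four_le_sum
  have hmid : ∀ i, T (midpoint ℝ (V i) (V (i + 1))) = midpoint ℝ (T (V i)) (T (V (i + 1))) :=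
    fun i => T.map_midpoint _ _
  rw [hratio, ht.area_eq hV]
  have hiff : Real.pi / (t 0 + t 1 + t 2 + t 3) = Real.pi / 4 ↔ t 0 + t 1 + t 2 + t 3 = 4 := by
    rw [div_eq_div_iff (by linarith) (by norm_num)]
    exact ⟨fun h => (mul_left_cancel₀ Real.pi_ne_zero h).symm, fun h => by rw [h]⟩
  refine ⟨div_le_div_of_nonneg_left Real.pi_pos.le (by norm_num) h4, hiff.trans ⟨fun hs => ?_,
    fun h => ht.sum_eq_of_midpoint fun i => T.injective ?_⟩⟩
  · have h1 := ht.eq_one_of_sum_eq hs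
    have hpar : ∀ i, ((Polygon.mk (T ∘ V.vertices)).sideLine i).Parallel
        ((Polygon.mk (T ∘ V.vertices)).sideLine (i + 2)) := by
      intro i
      have e : i + 2 + 1 = i + 3 := by rw [add_assoc]; rfl
      refine AffineSubspace.affineSpan_pair_parallel_iff_exists_unit_smul'.2 ⟨-1, ?_⟩
      have := congrArg T.linear (ht.sub_eq_neg_sub h1 i)
      have hl (x y : Plane) : T.linear (x - y) = T x -ᵥ T y :=
        (T : Plane →ᵃ[ℝ] Plane).linearMap_vsub x y
      rw [map_neg, hl, hl] at this
      rw [e]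
      simp only [Function.comp_apply, Units.neg_smul, one_smul]
      rw [this, neg_neg]
    refine ⟨⟨hpar 0, hpar 1⟩, fun i => ?_⟩
    have := hqt i
    rw [← hTu i, ht.eq_midpoint h1 i, hmid] at this
    exact this
  · rw [hTu, hmid]
    exact (hqt i).eq (h.2 i)

theorem theorem2p1 (D : Polygon Plane 4) (hD : D.IsConvexQuadrilateral)
    (E : Ellipse) (hE : E.InscribedIn D) :
    area E.region / area D.region ≤ Real.pi / 4 ∧
      (area E.region / area D.region = Real.pi / 4 ↔
        D.IsParallelogram ∧ E.TangentAtMidpoints D) := by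
  have key : ∀ T : Plane ≃ᵃ[ℝ] Plane, ∃ V : Polygon Plane 4, D = Polygon.mk (T ∘ V.vertices) := by
    intro T
    refine ⟨Polygon.mk (T.symm ∘ D.vertices), ?_⟩
    rw [← Function.comp_assoc, ← AffineEquiv.coe_trans]
    simp
  obtain ⟨T, hT⟩ := E.exists_form_affineEquiv
  obtain ⟨V, rfl⟩ := key T
  have hV := (Polygon.isConvexQuadrilateral_comp_iff T V).1 hD
  rcases hV.signedCross_pos_or_neg with h | h
  · exact area_ratio_of_form_eq hT h hV.ne hE
  -- Negative orientation: precomposing with the coordinate swap reverses all signs and preserves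
  -- the unit circle.
  · obtain ⟨W, hW⟩ := key (swapEquiv.toAffineEquiv.trans T)
    have hVW : ∀ i, V i = swapEquiv (W i) := fun i =>
      T.injective (congrFun (congrArg Polygon.vertices hW) i)
    rw [hW] at hD hE ⊢
    refine area_ratio_of_form_eq (fun x => ?_) (fun i => ?_)
      ((Polygon.isConvexQuadrilateral_comp_iff _ W).1 hD).ne hE
    · rw [AffineEquiv.trans_apply, hT]
      simp [swapEquiv, add_comm]
    · have := h i
      rw [hVW, hVW, hVW] at this
      simp [signedCross, swapEquiv] at this ⊢
      linarith
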